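/- For $f:\mathbb R^n\to\mathbb R$, consider the assumptions (with $p=2$): AS.1: $f$ is twice continuously differentiable; AS.2: $f$ is bounded below; AS.3: $\nabla^2 f$ is globally Lipschitz continuous; AS.4: there is $\kappa\le 0$ with $\min_{\|d\|\le 1}\nabla^2f(x)[d,d]\ge\kappa$ for all $x$. The simplified OFFAR2 algorithm, given $x_0$, $\sigma_0>0$, $\theta_1\geq 1$ and $\epsilon_1\in(0,1]$, does the following for $k=0,1,2,\dots$. It computes $g_k=\nabla f(x_k)$ and terminates if $\|g_k\|\le\epsilon_1$. Otherwise, if $k>0$, it sets $$\mu_{1,k}=\frac{2\|g_k\|}{\|s_{k-1}\|^2}-\theta_1\sigma_{k-1},\qquad \sigma_k=\max[\sigma_{k-1},\mu_{1,k}].$$ It then computes a step $s_k$ such that $m_k(s_k)<m_k(0)$ and $\|\nabla_s T_k(s_k)\|\le\frac{1}{2}\theta_1\sigma_k\|s_k\|^2$, where $$T_k(s)=f(x_k)+\nabla f(x_k)^Ts+\tfrac12\nabla^2f(x_k)[s,s],\qquad m_k(s)=T_k(s)+\tfrac{\sigma_k}{6}\|s\|^3,$$ and sets $x_{k+1}=x_k+s_k$.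 Theorem. For every $H\ge1$ there are twice continuously differentiable piecewise polynomial functions $f_1,f_2:\mathbb R\to\mathbb R$ satisfying AS.1--AS.4 (with locally finitely many pieces) such that $f(x)=f_1(x_1)+f_2(x_2)$ satisfies AS.1--AS.4 on $\mathbb R^2$ and such that, for every $\theta_1\ge1$ and every $\epsilon_1\in(0,1]$, the sequences $$x_k=k\begin{pmatrix}1\\ \frac1{H+1}\end{pmatrix},\qquad s_k=\begin{pmatrix}1\\ \frac1{H+1}\end{pmatrix},\qquad \sigma_k=\frac{2(H+1)}{\sqrt{1+(H+1)^2}}\qquad(k\ge0)$$ are the iterates, steps and regularization parameters of a never-terminating run of the simplified OFFAR2 algorithm applied to $f$ from $x_0=0$ with $\sigma_0=\frac{2(H+1)}{\sqrt{1+(H+1)^2}}$. In this run each $s_k$ is a global minimizer of $m_k$ and, for all $k\ge0$, $$f(x_k)=1,\qquad \nabla f(x_k)=-\begin{pmatrix}1\\1\end{pmatrix},\qquad \nabla^2f(x_k)=\begin{pmatrix}0&0\\0&H\end{pmatrix},\qquad \|\nabla f(x_k)\|=\sqrt2 .$$ In particular the simplified algorithm may fail to converge. -/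

import Mathlib

open scoped Nat

namespace OFFAR

noncomputable section

variable {E : Type*} [NormedAddCommGroup E] [InnerProductSpace ℝ E]

/-- AS.1: `f` is `p` times continuously differentiable. -/
def AS1 (p : ℕ) (f : E → ℝ) : Prop := ContDiff ℝ p f

/-- AS.2: `f` is bounded below. -/
def AS2 (f : E → ℝ) : Prop := ∃ flow : ℝ, ∀ x, flow ≤ f x

/-- AS.3: the `p`th derivative of `f` is globally Lipschitz continuous. -/
def AS3 (p : ℕ) (f : E → ℝ) : Prop :=
  ∃ L : ℝ, 0 ≤ L ∧ ∀ x y, ‖iteratedFDeriv ℝ p f x - iteratedFDeriv ℝ p f y‖ ≤ L * ‖x - y‖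

/-- AS.4: the forms `d ↦ ∇ⁱ f(x)[d]ⁱ`, `2 ≤ i ≤ p`, are bounded below on the unit ball,
uniformly in `x`. -/
def AS4 (p : ℕ) (f : E → ℝ) : Prop :=
  ∃ κ : ℝ, κ ≤ 0 ∧ ∀ x : E, ∀ i ∈ Finset.Icc 2 p, ∀ d : E, ‖d‖ ≤ 1 →
    κ ≤ iteratedFDeriv ℝ i f x (fun _ => d)

/-- The conjunction of AS.1, AS.2, AS.3 and AS.4. -/
structure Assumptions (p : ℕ) (f : E → ℝ) : Prop where
  as1 : AS1 p f
  as2 : AS2 f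
  as3 : AS3 p f
  as4 : AS4 p f

/-- The Taylor expansion `T_{f,p}(x,s) = f(x) + ∑_{i=1}^p (1/i!) ∇ⁱ f(x)[s]ⁱ`. -/
def taylor (p : ℕ) (f : E → ℝ) (x s : E) : ℝ :=
  f x + ∑ i ∈ Finset.Icc 1 p, (1 / (i ! : ℝ)) * iteratedFDeriv ℝ i f x (fun _ => s)

/-- The regularized model `m(s) = T_{f,p}(x,s) + σ/(p+1)! ‖s‖^{p+1}`. -/
def model (p : ℕ) (f : E → ℝ) (x : E) (σ : ℝ) (s : E) : ℝ :=
  taylor p f x s + σ / ((p + 1)! : ℝ) * ‖s‖ ^ (p + 1)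

variable [CompleteSpace E]

/-- `μ₁ = p! ‖∇f(x)‖ / ‖s‖^p - θ₁ σ`, where `x` is the current iterate and `s`, `σ` are the
previous step and regularization parameter. -/
def mu1 (p : ℕ) (f : E → ℝ) (θ₁ : ℝ) (x s : E) (σ : ℝ) : ℝ :=
  (p ! : ℝ) * ‖gradient f x‖ / ‖s‖ ^ p - θ₁ * σ

/-- The sequences `x`, `s`, `σ` are the iterates, steps and regularization parameters of an
execution that never terminates of the simplified OFFAR`p` algorithm, i.e. the one with the
update `σ_k = max[σ_{k-1}, μ_{1,k}]`, applied to `f` with starting point `x₀`, initial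
regularization parameter `σ₀`, parameter `θ₁` and accuracy `ε₁`. -/
structure IsInfiniteSimplifiedRun (p : ℕ) (f : E → ℝ) (x₀ : E) (σ₀ θ₁ ε₁ : ℝ)
    (x s : ℕ → E) (σ : ℕ → ℝ) : Prop where
  x_zero : x 0 = x₀
  σ_zero : σ 0 = σ₀
  /-- The termination test `‖g_k‖ ≤ ε₁` fails at every iteration. -/
  not_terminated : ∀ k, ¬ ‖gradient f (x k)‖ ≤ ε₁
  σ_update : ∀ k, σ (k + 1) = max (σ k) (mu1 p f θ₁ (x (k + 1)) (s k) (σ k))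
  descent : ∀ k, model p f (x k) (σ k) (s k) - model p f (x k) (σ k) 0 < 0
  grad_step : ∀ k, ‖gradient (taylor p f (x k)) (s k)‖ ≤ θ₁ * (σ k / (p ! : ℝ)) * ‖s k‖ ^ p
  x_update : ∀ k, x (k + 1) = x k + s k

/-- `h` agrees with a polynomial on each interval of some locally finite subdivision of `ℝ`. -/
def IsPiecewisePolynomial (h : ℝ → ℝ) : Prop :=
  ∃ (t : ℤ → ℝ) (P : ℤ → Polynomial ℝ), StrictMono t ∧
    Filter.Tendsto t Filter.atTop Filter.atTop ∧ Filter.Tendsto t Filter.atBot Filter.atBot ∧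
    ∀ i, ∀ y ∈ Set.Icc (t i) (t (i + 1)), h y = (P i).eval y

end

end OFFAR

/-!
The objective is a sum of two periodic splines whose periods are the two coordinates of the step
`s`. It is therefore invariant under translation by `s`, so every iteration is a copy of the first
one and only the origin has to be examined.

There the regularization parameter is chosen so that `σ‖s‖ = 2`. Since `t³` lies above its tangent
at `t = ‖s‖` as a function of `t²`, the cubic term `σ‖y‖³ / 6` lies above `‖y‖² / 2` plus a
constant, with equality at `y = s`. The quadratic Taylor model plus `‖y‖² / 2` has Hessian
`diag(1, H + 1)`, so it is convex, and its minimizer is `(1, 1 / (H + 1)) = s`; hence `s` minimizes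
the cubic model globally.
-/

namespace OFFAR

open Filter Function Polynomial Set
open scoped NNReal

section Assumptions

variable {E F : Type*} [NormedAddCommGroup E] [InnerProductSpace ℝ E]
  [NormedAddCommGroup F] [InnerProductSpace ℝ F] {p : ℕ}

theorem Assumptions.add {f g : E → ℝ} (hf : Assumptions p f) (hg : Assumptions p g) :
    Assumptions p (f + g) := by
  have iteratedFDeriv_add {i : ℕ} (hi : i ≤ p) (x : E) :
      iteratedFDeriv ℝ i (f + g) x = iteratedFDeriv ℝ i f x + iteratedFDeriv ℝ i g x :=
    have hi : (i : WithTop ℕ∞) ≤ p := mod_cast hi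
    iteratedFDeriv_add_apply (ContDiff.of_le hf.as1 hi).contDiffAt
      (ContDiff.of_le hg.as1 hi).contDiffAt
  obtain ⟨a, ha⟩ := hf.as2
  obtain ⟨b, hb⟩ := hg.as2
  obtain ⟨K, hK, hKf⟩ := hf.as3
  obtain ⟨L, hL, hLg⟩ := hg.as3
  obtain ⟨κ, hκ, hκf⟩ := hf.as4
  obtain ⟨ν, hν, hνg⟩ := hg.as4
  refine ⟨ContDiff.add hf.as1 hg.as1, ⟨a + b, fun x => add_le_add (ha x) (hb x)⟩,
    ⟨K + L, add_nonneg hK hL, fun x y => ?_⟩, ⟨κ + ν, add_nonpos hκ hν, fun x i hi d hd => ?_⟩⟩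
  · rw [iteratedFDeriv_add le_rfl, iteratedFDeriv_add le_rfl, add_sub_add_comm, add_mul]
    exact norm_add_le_of_le (hKf x y) (hLg x y)
  · rw [iteratedFDeriv_add (Finset.mem_Icc.1 hi).2]
    exact add_le_add (hκf x i hi d hd) (hνg x i hi d hd)

theorem AS3.comp_clm {f : F → ℝ} (hC : AS1 p f) (hf : AS3 p f) (l : E →L[ℝ] F) :
    AS3 p (f ∘ l) := by
  obtain ⟨L, hL, hLf⟩ := hf
  refine ⟨L * ‖l‖ * ‖l‖ ^ p, by positivity, fun x y => ?_⟩
  rw [l.iteratedFDeriv_comp_right hC x le_rfl, l.iteratedFDeriv_comp_right hC y le_rfl]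
  calc ‖(iteratedFDeriv ℝ p f (l x) - iteratedFDeriv ℝ p f (l y)).compContinuousLinearMap
          fun _ => l‖
      ≤ ‖iteratedFDeriv ℝ p f (l x) - iteratedFDeriv ℝ p f (l y)‖ * ‖l‖ ^ p := by
        simpa using ContinuousMultilinearMap.norm_compContinuousLinearMap_le
          (iteratedFDeriv ℝ p f (l x) - iteratedFDeriv ℝ p f (l y)) fun _ => l
    _ ≤ L * (‖l‖ * ‖x - y‖) * ‖l‖ ^ p := by
        gcongr
        refine (hLf _ _).trans ?_
        rw [← map_sub]
        gcongr
        exact l.le_opNorm _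
    _ = L * ‖l‖ * ‖l‖ ^ p * ‖x - y‖ := by ring

theorem AS4.comp_clm {f : F → ℝ} (hC : AS1 p f) (hf : AS4 p f) (l : E →L[ℝ] F) :
    AS4 p (f ∘ l) := by
  obtain ⟨κ, hκ, hκf⟩ := hf
  set c : ℝ := max 1 ‖l‖
  have hc : 1 ≤ c := le_max_left ..
  have hc₀ : 0 < c := one_pos.trans_le hc
  refine ⟨c ^ p * κ, mul_nonpos_of_nonneg_of_nonpos (by positivity) hκ, fun x i hi d hd => ?_⟩
  have hip : i ≤ p := (Finset.mem_Icc.1 hi).2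
  have norm_le_one : ‖c⁻¹ • l d‖ ≤ 1 := by
    rw [norm_smul, norm_inv, Real.norm_of_nonneg hc₀.le, inv_mul_le_iff₀ hc₀, mul_one]
    exact (l.unit_le_opNorm d hd).trans (le_max_right ..)
  rw [l.iteratedFDeriv_comp_right hC x (mod_cast hip)]
  calc c ^ p * κ ≤ c ^ i * κ :=
        mul_le_mul_of_nonpos_right (pow_le_pow_right₀ hc hip) hκ
    _ ≤ c ^ i * iteratedFDeriv ℝ i f (l x) fun _ => c⁻¹ • l d := by
        gcongr
        exact hκf _ i hi _ norm_le_one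
    _ = iteratedFDeriv ℝ i f (l x) fun _ => l d := by
        rw [ContinuousMultilinearMap.map_smul_univ]
        simp [hc₀.ne']

theorem Assumptions.comp_clm {f : F → ℝ} (hf : Assumptions p f) (l : E →L[ℝ] F) :
    Assumptions p (f ∘ l) where
  as1 := ContDiff.comp hf.as1 l.contDiff
  as2 := hf.as2.imp fun _ h x => h (l x)
  as3 := hf.as3.comp_clm hf.as1 l
  as4 := hf.as4.comp_clm hf.as1 l

theorem assumptions_real {g : ℝ → ℝ} (hC : ContDiff ℝ p g) (hbelow : ∃ m, ∀ t, m ≤ g t)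
    (hlip : ∃ K : ℝ≥0, LipschitzWith K (iteratedDeriv p g))
    (hbdd : ∀ i ∈ Finset.Icc 2 p, ∃ M, ∀ t, |iteratedDeriv i g t| ≤ M) : Assumptions p g := by
  refine ⟨hC, hbelow, ?_, ?_⟩
  · obtain ⟨K, hK⟩ := hlip
    refine ⟨K, K.2, fun x y => ?_⟩
    rw [iteratedFDeriv_eq_equiv_comp, comp_apply, comp_apply, ← map_sub,
      LinearIsometryEquiv.norm_map]
    exact hK.norm_sub_le x y
  · choose! M hM using hbdd
    have M_nonneg : ∀ i ∈ Finset.Icc 2 p, 0 ≤ M i :=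
      fun i hi => (abs_nonneg _).trans (hM i hi 0)
    refine ⟨-∑ i ∈ Finset.Icc 2 p, M i, neg_nonpos.2 (Finset.sum_nonneg M_nonneg),
      fun x i hi d hd => neg_le_of_abs_le ?_⟩
    rw [iteratedFDeriv_apply_eq_iteratedDeriv_mul_prod, Fin.prod_const, smul_eq_mul, abs_mul,
      abs_pow]
    calc |d| ^ i * |iteratedDeriv i g x| ≤ 1 * M i := by
          gcongr
          exacts [pow_le_one₀ (abs_nonneg d) hd, hM i hi x]
      _ ≤ ∑ j ∈ Finset.Icc 2 p, M j := by
          rw [one_mul]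
          exact Finset.single_le_sum M_nonneg hi

end Assumptions

section Periodize

theorem hasDerivAt_of_hasDerivWithinAt_Ici {E : Type*} [NormedAddCommGroup E] [NormedSpace ℝ E]
    [CompleteSpace E] {f f' : ℝ → E} (hf : Continuous f) (hf' : Continuous f')
    (hderiv : ∀ t, HasDerivWithinAt f (f' t) (Ici t) t) (t : ℝ) : HasDerivAt f (f' t) t := by
  have integral_eq (r : ℝ) : f r = (∫ u in (0 : ℝ)..r, f' u) + f 0 := by
    rw [intervalIntegral.integral_eq_sub_of_hasDeriv_right hf.continuousOn
      (fun u _ => (hderiv u).mono Ioi_subset_Ici_self) (hf'.intervalIntegrable 0 r), sub_add_cancel]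
  rw [funext integral_eq]
  exact (hf'.integral_hasStrictDerivAt 0 t).hasDerivAt.add_const (f 0)

/-- The `T`-periodic function that agrees with the polynomial `P` on `[0, T)`. -/
noncomputable def periodize (T : ℝ) (P : ℝ[X]) (t : ℝ) : ℝ := P.eval (Int.fract (t / T) * T)

/-- The polynomial `P` and its derivatives of order at most `p` take the same values at both ends
of `[0, T]`; this is what makes `periodize T P` of class `C^p`. -/
def ClosesUp (p : ℕ) (T : ℝ) (P : ℝ[X]) : Prop :=
  ∀ i ≤ p, (derivative^[i] P).eval 0 = (derivative^[i] P).eval T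

variable {T : ℝ} {P : ℝ[X]} {p : ℕ}

theorem periodize_zero (T : ℝ) (P : ℝ[X]) : periodize T P 0 = P.eval 0 := by
  simp [periodize]

theorem periodic_periodize (hT : T ≠ 0) (P : ℝ[X]) : Periodic (periodize T P) T := fun t => by
  rw [periodize, add_div, div_self hT, Int.fract_add_one, periodize]

theorem periodize_eq_of_mem_Ico (hT : 0 < T) (P : ℝ[X]) {n : ℤ} {t : ℝ}
    (ht : t ∈ Ico (n * T) ((n + 1) * T)) : periodize T P t = P.eval (t - n * T) := by
  have floor_eq : ⌊t / T⌋ = n :=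
    Int.floor_eq_iff.2 ⟨(le_div_iff₀ hT).2 ht.1, (div_lt_iff₀ hT).2 ht.2⟩
  rw [periodize, Int.fract, floor_eq, sub_mul, div_mul_cancel₀ _ hT.ne']

theorem mem_Ico_floor_div_mul (hT : 0 < T) (t : ℝ) :
    t ∈ Ico (⌊t / T⌋ * T) ((⌊t / T⌋ + 1) * T) :=
  ⟨(le_div_iff₀ hT).1 (Int.floor_le _), (div_lt_iff₀ hT).1 (Int.lt_floor_add_one _)⟩

theorem isPiecewisePolynomial_periodize (hT : 0 < T) (hP : P.eval 0 = P.eval T) :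
    IsPiecewisePolynomial (periodize T P) := by
  refine ⟨fun n => n * T, fun n => P.comp (X - C (n * T)),
    fun m n hmn => mul_lt_mul_of_pos_right (Int.cast_lt.2 hmn) hT,
    tendsto_intCast_atTop_atTop.atTop_mul_const hT,
    (tendsto_intCast_atBot_iff.2 tendsto_id).atBot_mul_const hT, fun n t ht => ?_⟩
  push_cast at ht
  rw [eval_comp, eval_sub, eval_X, eval_C]
  rcases ht.2.lt_or_eq with h | rfl
  · exact periodize_eq_of_mem_Ico hT P ⟨ht.1, h⟩
  · calc periodize T P ((n + 1) * T) = P.eval 0 := by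
          rw [← periodize_zero T]
          exact_mod_cast (periodic_periodize hT.ne' P).int_mul_eq (n + 1)
      _ = P.eval ((n + 1) * T - n * T) := by rw [hP]; congr 1; ring

theorem continuous_periodize (hP : P.eval 0 = P.eval T) : Continuous (periodize T P) :=
  (ContinuousOn.comp_fract'' (f := fun u => P.eval (u * T))
    (by fun_prop) (by simpa using hP)).comp (continuous_id.div_const T)

theorem hasDerivWithinAt_periodize_Ici (hT : 0 < T) (P : ℝ[X]) (t : ℝ) :
    HasDerivWithinAt (periodize T P) (periodize T P.derivative t) (Ici t) t := by
  have ht := mem_Ico_floor_div_mul hT t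
  rw [periodize_eq_of_mem_Ico hT _ ht]
  refine ((P.hasDerivAt _).comp_sub_const t (⌊t / T⌋ * T)).hasDerivWithinAt.congr_of_eventuallyEq ?_
    (periodize_eq_of_mem_Ico hT P ht)
  filter_upwards [Ico_mem_nhdsGE ht.2] with r hr
  exact periodize_eq_of_mem_Ico hT P ⟨ht.1.trans hr.1, hr.2⟩

theorem hasDerivAt_periodize (hT : 0 < T) (hP : P.eval 0 = P.eval T)
    (hP' : P.derivative.eval 0 = P.derivative.eval T) (t : ℝ) :
    HasDerivAt (periodize T P) (periodize T P.derivative t) t :=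
  hasDerivAt_of_hasDerivWithinAt_Ici (continuous_periodize hP) (continuous_periodize hP')
    (hasDerivWithinAt_periodize_Ici hT P) t

theorem exists_abs_periodize_le (hT : 0 < T) (P : ℝ[X]) : ∃ M, ∀ t, |periodize T P t| ≤ M := by
  obtain ⟨M, hM⟩ := (isCompact_Icc (a := 0) (b := T)).exists_bound_of_continuousOn
    P.continuous.continuousOn
  exact ⟨M, fun t => hM _ ⟨mul_nonneg (Int.fract_nonneg _) hT.le,
    mul_le_of_le_one_left hT.le (Int.fract_lt_one _).le⟩⟩

theorem exists_lipschitzWith_periodize (hT : 0 < T) (hP : P.eval 0 = P.eval T) :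
    ∃ K : ℝ≥0, LipschitzWith K (periodize T P) := by
  obtain ⟨M, hM⟩ := exists_abs_periodize_le hT P.derivative
  refine ⟨⟨M, (abs_nonneg _).trans (hM 0)⟩, LipschitzWith.of_dist_le_mul fun a b => ?_⟩
  wlog hab : b ≤ a generalizing a b
  · rw [dist_comm, dist_comm a]
    exact this b a (le_of_not_ge hab)
  rw [Real.dist_eq a b, abs_of_nonneg (sub_nonneg.2 hab)]
  exact norm_image_sub_le_of_norm_deriv_right_le_segment (continuous_periodize hP).continuousOn
    (fun t _ => hasDerivWithinAt_periodize_Ici hT P t) (fun t _ => hM t) a ⟨hab, le_rfl⟩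

theorem ClosesUp.iteratedDeriv_periodize (hP : ClosesUp p T P) (hT : 0 < T) {i : ℕ} (hi : i ≤ p) :
    iteratedDeriv i (periodize T P) = periodize T (derivative^[i] P) := by
  induction i with
  | zero => exact iteratedDeriv_zero
  | succ i ih =>
    have hP' := hP (i + 1) hi
    rw [iterate_succ_apply'] at hP'
    rw [iteratedDeriv_succ, ih (by lia), iterate_succ_apply']
    exact funext fun t => (hasDerivAt_periodize hT (hP i (by lia)) hP' t).deriv

theorem ClosesUp.contDiff_periodize (hP : ClosesUp p T P) (hT : 0 < T) :
    ContDiff ℝ p (periodize T P) := by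
  refine contDiff_nat_iff_iteratedDeriv.2 ⟨fun i hi => ?_, fun i hi => ?_⟩
  · rw [hP.iteratedDeriv_periodize hT hi]
    exact continuous_periodize (hP i hi)
  · have hP' := hP (i + 1) hi
    rw [iterate_succ_apply'] at hP'
    rw [hP.iteratedDeriv_periodize hT hi.le]
    exact fun t => (hasDerivAt_periodize hT (hP i hi.le) hP' t).differentiableAt

theorem ClosesUp.assumptions_periodize (hP : ClosesUp p T P) (hT : 0 < T) :
    Assumptions p (periodize T P) := by
  refine assumptions_real (hP.contDiff_periodize hT) ?_ ?_ fun i hi => ?_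
  · obtain ⟨M, hM⟩ := exists_abs_periodize_le hT P
    exact ⟨-M, fun t => neg_le_of_abs_le (hM t)⟩
  · rw [hP.iteratedDeriv_periodize hT le_rfl]
    exact exists_lipschitzWith_periodize hT (hP p le_rfl)
  · rw [hP.iteratedDeriv_periodize hT (Finset.mem_Icc.1 hi).2]
    exact exists_abs_periodize_le hT _

end Periodize

section PeriodicSpline

variable {T : ℝ}

/-- The quintic with value `c`, first derivative `b` and second derivative `e` at both ends of
`[0, T]`. -/
noncomputable def hermiteQuintic (T c b e : ℝ) : ℝ[X] :=
  C c + C b * (X - C (10 / T ^ 2) * X ^ 3 + C (15 / T ^ 3) * X ^ 4 - C (6 / T ^ 4) * X ^ 5) +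
    C (e / 2) * (X ^ 2 - C (2 / T) * X ^ 3 + C (1 / T ^ 2) * X ^ 4)

theorem eval_hermiteQuintic (T c b e t : ℝ) :
    (hermiteQuintic T c b e).eval t =
      c + b * (t - 10 / T ^ 2 * t ^ 3 + 15 / T ^ 3 * t ^ 4 - 6 / T ^ 4 * t ^ 5) +
        e / 2 * (t ^ 2 - 2 / T * t ^ 3 + 1 / T ^ 2 * t ^ 4) := by
  simp [hermiteQuintic]

theorem eval_derivative_hermiteQuintic (T c b e t : ℝ) :
    (hermiteQuintic T c b e).derivative.eval t =
      b * (1 - 30 / T ^ 2 * t ^ 2 + 60 / T ^ 3 * t ^ 3 - 30 / T ^ 4 * t ^ 4) +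
        e * (t - 3 / T * t ^ 2 + 2 / T ^ 2 * t ^ 3) := by
  simp only [hermiteQuintic, derivative_add, derivative_sub, derivative_C_mul, derivative_C,
    derivative_X_pow, derivative_X, eval_add, eval_sub, eval_mul, eval_C, eval_X, eval_pow,
    eval_zero, eval_one, Nat.cast_ofNat]
  ring

theorem eval_derivative_derivative_hermiteQuintic (T c b e t : ℝ) :
    (hermiteQuintic T c b e).derivative.derivative.eval t =
      b * (-60 / T ^ 2 * t + 180 / T ^ 3 * t ^ 2 - 120 / T ^ 4 * t ^ 3) +
        e * (1 - 6 / T * t + 6 / T ^ 2 * t ^ 2) := by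
  simp only [hermiteQuintic, derivative_add, derivative_sub, derivative_C_mul, derivative_C,
    derivative_X_pow, derivative_X, derivative_one, derivative_zero, eval_add, eval_sub, eval_mul,
    eval_C, eval_X, eval_pow, eval_zero, Nat.cast_ofNat]
  ring

theorem closesUp_hermiteQuintic (hT : T ≠ 0) (c b e : ℝ) :
    ClosesUp 2 T (hermiteQuintic T c b e) := by
  intro i hi
  interval_cases i
  · simp only [iterate_zero_apply, eval_hermiteQuintic]
    field_simp
    ring
  · simp only [iterate_one, eval_derivative_hermiteQuintic]
    field_simp
    ring
  · simp only [iterate_succ_apply, iterate_zero_apply, eval_derivative_derivative_hermiteQuintic]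
    field_simp
    ring

/-- A `T`-periodic piecewise polynomial function of class `C²` with value `c`, first derivative `b`
and second derivative `e` at every multiple of `T`. -/
noncomputable def periodicSpline (T c b e : ℝ) : ℝ → ℝ := periodize T (hermiteQuintic T c b e)

theorem periodic_periodicSpline (hT : T ≠ 0) (c b e : ℝ) : Periodic (periodicSpline T c b e) T :=
  periodic_periodize hT _

theorem isPiecewisePolynomial_periodicSpline (hT : 0 < T) (c b e : ℝ) :
    IsPiecewisePolynomial (periodicSpline T c b e) :=
  isPiecewisePolynomial_periodize hT (closesUp_hermiteQuintic hT.ne' c b e 0 zero_le_two)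

theorem assumptions_periodicSpline (hT : 0 < T) (c b e : ℝ) :
    Assumptions 2 (periodicSpline T c b e) :=
  (closesUp_hermiteQuintic hT.ne' c b e).assumptions_periodize hT

theorem periodicSpline_zero (T c b e : ℝ) : periodicSpline T c b e 0 = c := by
  simp [periodicSpline, periodize_zero, eval_hermiteQuintic]

theorem hasDerivAt_periodicSpline_zero (hT : 0 < T) (c b e : ℝ) :
    HasDerivAt (periodicSpline T c b e) b 0 := by
  have hP := closesUp_hermiteQuintic hT.ne' c b e
  refine (hasDerivAt_periodize hT (hP 0 zero_le_two) (hP 1 one_le_two) 0).congr_deriv ?_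
  simp [periodize_zero, eval_derivative_hermiteQuintic]

theorem iteratedDeriv_two_periodicSpline_zero (hT : 0 < T) (c b e : ℝ) :
    iteratedDeriv 2 (periodicSpline T c b e) 0 = e := by
  rw [periodicSpline, (closesUp_hermiteQuintic hT.ne' c b e).iteratedDeriv_periodize hT le_rfl,
    periodize_zero]
  simp [eval_derivative_derivative_hermiteQuintic]

end PeriodicSpline

section Translation

theorem periodic_natCast_smul (R : Type*) {M α : Type*} [Semiring R] [AddCommMonoid M]
    [Module R M] {g : M → α} {v : M} (hg : Periodic g v) (k : ℕ) :
    Periodic g ((k : R) • v) := by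
  rw [Nat.cast_smul_eq_nsmul]
  exact hg.nsmul k

theorem periodic_iteratedFDeriv (𝕜 : Type*) {E F : Type*} [NontriviallyNormedField 𝕜]
    [NormedAddCommGroup E] [NormedSpace 𝕜 E] [NormedAddCommGroup F] [NormedSpace 𝕜 F]
    {f : E → F} {v : E} (hf : Periodic f v) (n : ℕ) :
    Periodic (iteratedFDeriv 𝕜 n f) v := fun x => by
  rw [← iteratedFDeriv_comp_add_right, hf.funext]

variable {E : Type*} [NormedAddCommGroup E] [InnerProductSpace ℝ E] {p : ℕ} {f : E → ℝ} {v : E}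

theorem periodic_model (hf : Periodic f v) (p : ℕ) (σ : ℝ) :
    Periodic (fun x => model p f x σ) v := fun x => by
  funext s
  simp only [model, taylor, hf x, periodic_iteratedFDeriv ℝ hf _ x]

theorem periodic_taylor (hf : Periodic f v) (p : ℕ) : Periodic (taylor p f) v := fun x => by
  funext s
  simp only [taylor, hf x, periodic_iteratedFDeriv ℝ hf _ x]

variable [CompleteSpace E]

theorem periodic_gradient (hf : Periodic f v) : Periodic (gradient f) v := fun x => by
  rw [gradient, ← fderiv_comp_add_right, hf.funext, gradient]

theorem isInfiniteSimplifiedRun_of_periodic {x₀ s : E} {σ θ₁ ε₁ : ℝ} {x : ℕ → E}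
    (hx : ∀ k : ℕ, x k = x₀ + (k : ℝ) • s) (hf : Periodic f s)
    (hε₁ : ε₁ < ‖gradient f x₀‖) (hμ : mu1 p f θ₁ x₀ s σ ≤ σ)
    (hdescent : model p f x₀ σ s < model p f x₀ σ 0)
    (hgrad : ‖gradient (taylor p f x₀) s‖ ≤ θ₁ * (σ / (p ! : ℝ)) * ‖s‖ ^ p) :
    IsInfiniteSimplifiedRun p f x₀ σ θ₁ ε₁ x (fun _ => s) (fun _ => σ) := by
  have eq_initial {α : Type _} {g : E → α} (hg : Periodic g s) (k : ℕ) : g (x k) = g x₀ := by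
    rw [hx]
    exact periodic_natCast_smul ℝ hg k x₀
  have gradient_eq := eq_initial (periodic_gradient hf)
  refine ⟨by simp [hx], rfl, fun k => ?_, fun k => ?_, fun k => ?_, fun k => ?_, fun k => ?_⟩
  · rwa [gradient_eq, not_le]
  · rw [mu1, gradient_eq]
    exact (max_eq_left hμ).symm
  · have model_eq := eq_initial (periodic_model hf p σ) k
    rw [model_eq]
    exact sub_neg.2 hdescent
  · rwa [eq_initial (periodic_taylor hf p)]
  · rw [hx, hx, Nat.cast_succ, add_smul, one_smul, add_assoc]

end Translation

section CubicRegularization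

variable {E : Type*} [NormedAddCommGroup E]

theorem cube_tangent_le {r t : ℝ} (hr : 0 ≤ r) (ht : 0 ≤ t) :
    r ^ 3 / 6 + r / 4 * (t ^ 2 - r ^ 2) ≤ t ^ 3 / 6 := by
  have h : 0 ≤ (t - r) ^ 2 * (2 * t + r) := by positivity
  linarith

theorem isMinOn_add_norm_cube {q : E → ℝ} {σ : ℝ} {S : Set E} {s : E} (hσ : 0 ≤ σ)
    (hs : IsMinOn (fun y => q y + σ * ‖s‖ / 4 * ‖y‖ ^ 2) S s) :
    IsMinOn (fun y => q y + σ / 6 * ‖y‖ ^ 3) S s := fun y hy => by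
  have hquad : q s + σ * ‖s‖ / 4 * ‖s‖ ^ 2 ≤ q y + σ * ‖s‖ / 4 * ‖y‖ ^ 2 := hs hy
  have hcube := mul_le_mul_of_nonneg_left (cube_tangent_le (norm_nonneg s) (norm_nonneg y)) hσ
  change q s + σ / 6 * ‖s‖ ^ 3 ≤ q y + σ / 6 * ‖y‖ ^ 3
  linarith

end CubicRegularization

section Separable

local notation "E₂" => EuclideanSpace ℝ (Fin 2)

/-- The function `(x₁, x₂) ↦ g x₁ + h x₂` on the Euclidean plane. -/
def separableSum (g h : ℝ → ℝ) (y : E₂) : ℝ := g (y 0) + h (y 1)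

variable {g h : ℝ → ℝ} {p : ℕ}

theorem periodic_separableSum {v : E₂} (hg : Periodic g (v 0)) (hh : Periodic h (v 1)) :
    Periodic (separableSum g h) v := fun y => by
  simp only [separableSum, PiLp.add_apply, hg (y 0), hh (y 1)]

theorem separableSum_eq_comp_add_comp (g h : ℝ → ℝ) :
    separableSum g h = g ∘ EuclideanSpace.proj (𝕜 := ℝ) (0 : Fin 2) +
      h ∘ EuclideanSpace.proj (𝕜 := ℝ) (1 : Fin 2) := rfl

theorem assumptions_separableSum (hg : Assumptions p g) (hh : Assumptions p h) :
    Assumptions p (separableSum g h) := by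
  rw [separableSum_eq_comp_add_comp]
  exact (hg.comp_clm _).add (hh.comp_clm _)

theorem hasGradientAt_separableSum {y : E₂} {a b : ℝ} (hg : HasDerivAt g a (y 0))
    (hh : HasDerivAt h b (y 1)) : HasGradientAt (separableSum g h) (!₂[a, b]) y := by
  rw [hasGradientAt_iff_hasFDerivAt, separableSum_eq_comp_add_comp]
  refine ((hg.comp_hasFDerivAt y (EuclideanSpace.proj (𝕜 := ℝ) (0 : Fin 2)).hasFDerivAt).add
    (hh.comp_hasFDerivAt y (EuclideanSpace.proj (𝕜 := ℝ) (1 : Fin 2)).hasFDerivAt)).congr_fderiv ?_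
  ext v
  simp [PiLp.inner_apply, Fin.sum_univ_two, mul_comm]

theorem iteratedFDeriv_separableSum {n : ℕ} (hg : ContDiff ℝ n g) (hh : ContDiff ℝ n h) (y : E₂)
    (m : Fin n → E₂) :
    iteratedFDeriv ℝ n (separableSum g h) y m =
      (∏ i, m i 0) * iteratedDeriv n g (y 0) + (∏ i, m i 1) * iteratedDeriv n h (y 1) := by
  rw [separableSum_eq_comp_add_comp, iteratedFDeriv_add_apply
      (hg.comp (EuclideanSpace.proj (0 : Fin 2)).contDiff).contDiffAt
      (hh.comp (EuclideanSpace.proj (1 : Fin 2)).contDiff).contDiffAt,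
    ContinuousLinearMap.iteratedFDeriv_comp_right _ hg y le_rfl,
    ContinuousLinearMap.iteratedFDeriv_comp_right _ hh y le_rfl]
  simp [iteratedFDeriv_apply_eq_iteratedDeriv_mul_prod]

theorem taylor_separableSum (hg : ContDiff ℝ p g) (hh : ContDiff ℝ p h) (x s : E₂) :
    taylor p (separableSum g h) x s = taylor p g (x 0) (s 0) + taylor p h (x 1) (s 1) := by
  have iteratedFDeriv_eq {i : ℕ} (hi : i ∈ Finset.Icc 1 p) :
      iteratedFDeriv ℝ i (separableSum g h) x (fun _ => s) =
        iteratedFDeriv ℝ i g (x 0) (fun _ => s 0) + iteratedFDeriv ℝ i h (x 1) fun _ => s 1 := by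
    have hi : (i : WithTop ℕ∞) ≤ p := mod_cast (Finset.mem_Icc.1 hi).2
    simp only [iteratedFDeriv_separableSum (hg.of_le hi) (hh.of_le hi),
      iteratedFDeriv_apply_eq_iteratedDeriv_mul_prod, smul_eq_mul]
  rw [taylor, Finset.sum_congr rfl fun i hi => by rw [iteratedFDeriv_eq hi, mul_add],
    Finset.sum_add_distrib, taylor, taylor, separableSum]
  ring

end Separable

theorem taylor_two_real (g : ℝ → ℝ) (x s : ℝ) :
    taylor 2 g x s = g x + deriv g x * s + iteratedDeriv 2 g x / 2 * s ^ 2 := by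
  simp only [taylor, show Finset.Icc 1 2 = {1, 2} from rfl, Finset.sum_pair one_lt_two.ne,
    iteratedFDeriv_apply_eq_iteratedDeriv_mul_prod, Fin.prod_const, iteratedDeriv_one, smul_eq_mul,
    Nat.factorial_one, Nat.factorial_two, Nat.cast_one, Nat.cast_ofNat]
  ring

section Counterexample

local notation "E₂" => EuclideanSpace ℝ (Fin 2)

variable {H : ℝ}

/-- The step `(1, 1 / (H + 1))` taken at every iteration of the counterexample. -/
noncomputable def step (H : ℝ) : E₂ := !₂[1, 1 / (H + 1)]

/-- The regularization parameter used at every iteration of the counterexample. -/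
noncomputable def regularizer (H : ℝ) : ℝ := 2 * (H + 1) / √(1 + (H + 1) ^ 2)

/-- The first summand `f₁` of the objective function. -/
noncomputable def summand₁ : ℝ → ℝ := periodicSpline 1 1 (-1) 0

/-- The second summand `f₂` of the objective function. -/
noncomputable def summand₂ (H : ℝ) : ℝ → ℝ := periodicSpline (1 / (H + 1)) 0 (-1) H

/-- The objective function `f` of the counterexample. -/
noncomputable def objective (H : ℝ) : E₂ → ℝ := separableSum summand₁ (summand₂ H)

theorem step_second_pos (hH : -1 < H) : 0 < 1 / (H + 1) :=
  one_div_pos.2 (neg_lt_iff_pos_add.1 hH)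

theorem step_zero (H : ℝ) : step H 0 = 1 := rfl

theorem step_one (H : ℝ) : step H 1 = 1 / (H + 1) := rfl

theorem norm_sq_step (H : ℝ) : ‖step H‖ ^ 2 = 1 + (1 / (H + 1)) ^ 2 := by
  simp [step, EuclideanSpace.norm_sq_eq, Fin.sum_univ_two]

theorem one_le_norm_step (H : ℝ) : 1 ≤ ‖step H‖ := by
  rw [← one_le_sq_iff₀ (norm_nonneg _), norm_sq_step]
  exact le_add_of_nonneg_right (sq_nonneg _)

theorem regularizer_mul_norm_step (hH : -1 < H) : regularizer H * ‖step H‖ = 2 := by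
  have hH1 : 0 < H + 1 := neg_lt_iff_pos_add.1 hH
  have hnorm : 0 < ‖step H‖ := one_pos.trans_le (one_le_norm_step H)
  have sqrt_eq : √(1 + (H + 1) ^ 2) = (H + 1) * ‖step H‖ := by
    rw [Real.sqrt_eq_iff_eq_sq (by positivity) (by positivity), mul_pow, norm_sq_step]
    field_simp
    ring
  rw [regularizer, sqrt_eq]
  field_simp

theorem regularizer_pos (hH : -1 < H) : 0 < regularizer H :=
  pos_of_mul_pos_left ((regularizer_mul_norm_step hH).symm ▸ two_pos) (norm_nonneg _)

theorem assumptions_objective (hH : -1 < H) : Assumptions 2 (objective H) :=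
  assumptions_separableSum (assumptions_periodicSpline one_pos ..)
    (assumptions_periodicSpline (step_second_pos hH) ..)

theorem periodic_objective (hH : -1 < H) : Periodic (objective H) (step H) :=
  periodic_separableSum (periodic_periodicSpline one_ne_zero _ _ _)
    (periodic_periodicSpline (step_second_pos hH).ne' _ _ _)

theorem objective_zero (H : ℝ) : objective H 0 = 1 := by
  simp [objective, separableSum, summand₁, summand₂, periodicSpline_zero]

theorem gradient_objective_zero (hH : -1 < H) : gradient (objective H) 0 = !₂[-1, -1] :=
  (hasGradientAt_separableSum (hasDerivAt_periodicSpline_zero one_pos ..)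
    (hasDerivAt_periodicSpline_zero (step_second_pos hH) ..)).gradient

theorem norm_gradient_objective_zero (hH : -1 < H) : ‖gradient (objective H) 0‖ = √2 := by
  rw [gradient_objective_zero hH, EuclideanSpace.norm_eq, Fin.sum_univ_two]
  norm_num

theorem iteratedFDeriv_two_objective_zero (hH : -1 < H) (u v : E₂) :
    iteratedFDeriv ℝ 2 (objective H) 0 ![u, v] = H * u 1 * v 1 := by
  have hT := step_second_pos hH
  rw [objective, summand₁, summand₂,
    iteratedFDeriv_separableSum (assumptions_periodicSpline one_pos ..).as1
      (assumptions_periodicSpline hT ..).as1]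
  simp only [PiLp.zero_apply, iteratedDeriv_two_periodicSpline_zero one_pos,
    iteratedDeriv_two_periodicSpline_zero hT, Fin.prod_univ_two, Matrix.cons_val_zero,
    Matrix.cons_val_one]
  ring

theorem taylor_objective_zero (hH : -1 < H) :
    taylor 2 (objective H) 0 =
      separableSum (fun t => 1 - t) fun t => H / 2 * t ^ 2 - t := by
  have hT := step_second_pos hH
  funext y
  rw [objective, summand₁, summand₂,
    taylor_separableSum (assumptions_periodicSpline one_pos ..).as1
      (assumptions_periodicSpline hT ..).as1]
  simp only [taylor_two_real, PiLp.zero_apply, periodicSpline_zero,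
    (hasDerivAt_periodicSpline_zero one_pos ..).deriv,
    (hasDerivAt_periodicSpline_zero hT ..).deriv,
    iteratedDeriv_two_periodicSpline_zero one_pos, iteratedDeriv_two_periodicSpline_zero hT,
    separableSum]
  ring

theorem model_objective_zero (hH : -1 < H) (σ : ℝ) (y : E₂) :
    model 2 (objective H) 0 σ y =
      1 - y 0 - y 1 + H / 2 * y 1 ^ 2 + σ / 6 * ‖y‖ ^ 3 := by
  rw [model, taylor_objective_zero hH, separableSum, show ((2 + 1)! : ℝ) = 6 by norm_num]
  ring

theorem isMinOn_model_objective_zero (hH : -1 < H) :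
    IsMinOn (model 2 (objective H) 0 (regularizer H)) univ (step H) := by
  have hH1 : 0 < H + 1 := neg_lt_iff_pos_add.1 hH
  rw [funext (model_objective_zero hH _)]
  refine isMinOn_add_norm_cube (regularizer_pos hH).le fun y _ => ?_
  have complete_square (z : E₂) :
      1 - z 0 - z 1 + H / 2 * z 1 ^ 2 + regularizer H * ‖step H‖ / 4 * ‖z‖ ^ 2 =
        (z 0 - 1) ^ 2 / 2 + (H + 1) / 2 * (z 1 - 1 / (H + 1)) ^ 2 +
          (1 / 2 - 1 / (2 * (H + 1))) := by
    rw [regularizer_mul_norm_step hH, EuclideanSpace.norm_sq_eq, Fin.sum_univ_two]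
    simp only [Real.norm_eq_abs, sq_abs]
    field_simp
    ring
  simp only [mem_ofPred_eq, complete_square]
  rw [step_zero, step_one]
  have squares_nonneg :
      0 ≤ (y 0 - 1) ^ 2 / 2 + (H + 1) / 2 * (y 1 - 1 / (H + 1)) ^ 2 := by positivity
  linarith

theorem model_objective_zero_step_lt (hH : -1 < H) :
    model 2 (objective H) 0 (regularizer H) (step H) <
      model 2 (objective H) 0 (regularizer H) 0 := by
  have hH1 : 0 < H + 1 := neg_lt_iff_pos_add.1 hH
  have cube_eq : regularizer H / 6 * ‖step H‖ ^ 3 = (1 + (1 / (H + 1)) ^ 2) / 3 := by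
    linear_combination ‖step H‖ ^ 2 / 6 * regularizer_mul_norm_step hH + norm_sq_step H / 3
  have decrease : 0 < 2 / 3 + 1 / (2 * (H + 1)) + 1 / (6 * (H + 1) ^ 2) := by positivity
  rw [model_objective_zero hH, model_objective_zero hH, cube_eq, ← sub_pos]
  convert decrease using 1
  simp only [step_zero, step_one, PiLp.zero_apply, norm_zero]
  field_simp
  ring

theorem gradient_taylor_objective_zero_step (hH : -1 < H) :
    gradient (taylor 2 (objective H) 0) (step H) = -step H := by
  have hH1 : H + 1 ≠ 0 := (neg_lt_iff_pos_add.1 hH).ne'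
  have deriv₁ : HasDerivAt (fun t : ℝ => 1 - t) (-1) (step H 0) :=
    (hasDerivAt_id _).const_sub 1
  have deriv₂ : HasDerivAt (fun t => H / 2 * t ^ 2 - t) (-(1 / (H + 1))) (step H 1) := by
    refine (((hasDerivAt_pow 2 _).const_mul _).sub (hasDerivAt_id _)).congr_deriv ?_
    simp only [step_one, Nat.cast_ofNat, Nat.add_one_sub_one, pow_one]
    field_simp
    ring
  rw [taylor_objective_zero hH, (hasGradientAt_separableSum deriv₁ deriv₂).gradient]
  ext i
  fin_cases i <;> rfl

theorem mu1_objective_zero_le (hH : -1 < H) {θ₁ : ℝ} (hθ₁ : 1 ≤ θ₁) :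
    mu1 2 (objective H) θ₁ 0 (step H) (regularizer H) ≤ regularizer H := by
  have hnorm := one_le_norm_step H
  have quotient_le : 2 * √2 / ‖step H‖ ^ 2 ≤ 2 * regularizer H := by
    rw [div_le_iff₀ (by positivity)]
    calc 2 * √2 ≤ 4 * ‖step H‖ := by linarith [Real.sqrt_two_lt_three_halves]
      _ = 2 * regularizer H * ‖step H‖ ^ 2 := by
        linear_combination -2 * ‖step H‖ * regularizer_mul_norm_step hH
  rw [mu1, norm_gradient_objective_zero hH, Nat.factorial_two, Nat.cast_ofNat]
  linarith [le_mul_of_one_le_left (regularizer_pos hH).le hθ₁]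

theorem isInfiniteSimplifiedRun_objective (hH : -1 < H) {θ₁ ε₁ : ℝ} (hθ₁ : 1 ≤ θ₁)
    (hε₁ : ε₁ ≤ 1) :
    IsInfiniteSimplifiedRun 2 (objective H) 0 (regularizer H) θ₁ ε₁
      (fun k => (k : ℝ) • step H) (fun _ => step H) (fun _ => regularizer H) := by
  refine isInfiniteSimplifiedRun_of_periodic (fun k => (zero_add _).symm) (periodic_objective hH)
    ?_ (mu1_objective_zero_le hH hθ₁) (model_objective_zero_step_lt hH) ?_
  · rw [norm_gradient_objective_zero hH]
    exact hε₁.trans_lt Real.one_lt_sqrt_two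
  · rw [gradient_taylor_objective_zero_step hH, norm_neg, Nat.factorial_two, Nat.cast_ofNat]
    calc ‖step H‖ ≤ θ₁ * ‖step H‖ := le_mul_of_one_le_left (norm_nonneg _) hθ₁
      _ = θ₁ * (regularizer H / 2) * ‖step H‖ ^ 2 := by
        linear_combination -(θ₁ * ‖step H‖ / 2) * regularizer_mul_norm_step hH

end Counterexample

end OFFAR

open OFFAR in
theorem mainTheorem7_general (H : ℝ) (hH : -1 < H) :
    ∃ (f : EuclideanSpace ℝ (Fin 2) → ℝ) (f₁ f₂ : ℝ → ℝ)
      (x s : ℕ → EuclideanSpace ℝ (Fin 2)) (σ : ℕ → ℝ),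
      OFFAR.Assumptions 2 f ∧
      OFFAR.Assumptions 2 f₁ ∧ OFFAR.IsPiecewisePolynomial f₁ ∧
      OFFAR.Assumptions 2 f₂ ∧ OFFAR.IsPiecewisePolynomial f₂ ∧
      (∀ y, f y = f₁ (y 0) + f₂ (y 1)) ∧
      (∀ k, s k = !₂[1, 1 / (H + 1)]) ∧
      (∀ k, x k = (k : ℝ) • !₂[1, 1 / (H + 1)]) ∧
      (∀ k, σ k = 2 * (H + 1) / √(1 + (H + 1) ^ 2)) ∧
      (∀ θ₁ : ℝ, 1 ≤ θ₁ → ∀ ε₁ ∈ Set.Ioc (0 : ℝ) 1,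
        OFFAR.IsInfiniteSimplifiedRun 2 f 0 (2 * (H + 1) / √(1 + (H + 1) ^ 2)) θ₁ ε₁ x s σ) ∧
      (∀ k, IsMinOn (OFFAR.model 2 f (x k) (σ k)) Set.univ (s k)) ∧
      (∀ k, f (x k) = 1) ∧
      (∀ k, gradient f (x k) = !₂[-1, -1]) ∧
      (∀ k u v, iteratedFDeriv ℝ 2 f (x k) ![u, v] = H * u 1 * v 1) ∧
      (∀ k, ‖gradient f (x k)‖ = √2) := by
  have hT : 0 < 1 / (H + 1) := step_second_pos hH
  have hf : Function.Periodic (objective H) (step H) := periodic_objective hH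
  have eq_zero {α : Type} {g : EuclideanSpace ℝ (Fin 2) → α} (hg : Function.Periodic g (step H))
      (k : ℕ) : g ((k : ℝ) • step H) = g 0 := (periodic_natCast_smul ℝ hg k).eq
  have gradient_eq := eq_zero (periodic_gradient hf)
  refine ⟨objective H, summand₁, summand₂ H, fun k => (k : ℝ) • step H, fun _ => step H,
    fun _ => regularizer H, assumptions_objective hH,
    assumptions_periodicSpline one_pos .., isPiecewisePolynomial_periodicSpline one_pos ..,
    assumptions_periodicSpline hT .., isPiecewisePolynomial_periodicSpline hT ..,
    fun _ => rfl, fun _ => rfl, fun _ => rfl, fun _ => rfl,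
    fun θ₁ hθ₁ ε₁ hε₁ => isInfiniteSimplifiedRun_objective hH hθ₁ hε₁.2,
    fun k => ?_, fun k => ?_, fun k => ?_, fun k u v => ?_, fun k => ?_⟩
  · exact (eq_zero (periodic_model hf 2 (regularizer H)) k).symm ▸ isMinOn_model_objective_zero hH
  · exact (eq_zero hf k).trans (objective_zero H)
  · exact (gradient_eq k).trans (gradient_objective_zero hH)
  · rw [eq_zero (periodic_iteratedFDeriv ℝ hf 2) k, iteratedFDeriv_two_objective_zero hH]
  · rw [gradient_eq, norm_gradient_objective_zero hH]

theorem mainTheorem7 (H : ℝ) (hH : 1 ≤ H) :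
    ∃ (f : EuclideanSpace ℝ (Fin 2) → ℝ) (f₁ f₂ : ℝ → ℝ)
      (x s : ℕ → EuclideanSpace ℝ (Fin 2)) (σ : ℕ → ℝ),
      -- the objective function
      OFFAR.Assumptions 2 f ∧
      OFFAR.Assumptions 2 f₁ ∧ OFFAR.IsPiecewisePolynomial f₁ ∧
      OFFAR.Assumptions 2 f₂ ∧ OFFAR.IsPiecewisePolynomial f₂ ∧
      (∀ y, f y = f₁ (y 0) + f₂ (y 1)) ∧
      -- the sequences
      (∀ k, s k = !₂[1, 1 / (H + 1)]) ∧
      (∀ k, x k = (k : ℝ) • !₂[1, 1 / (H + 1)]) ∧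
      (∀ k, σ k = 2 * (H + 1) / √(1 + (H + 1) ^ 2)) ∧
      -- they form an infinite run of the simplified algorithm, with exact model minimization
      (∀ θ₁ : ℝ, 1 ≤ θ₁ → ∀ ε₁ ∈ Set.Ioc (0 : ℝ) 1,
        OFFAR.IsInfiniteSimplifiedRun 2 f 0 (2 * (H + 1) / √(1 + (H + 1) ^ 2)) θ₁ ε₁ x s σ) ∧
      (∀ k, IsMinOn (OFFAR.model 2 f (x k) (σ k)) Set.univ (s k)) ∧
      -- values, gradients and Hessians at the iterates
      (∀ k, f (x k) = 1) ∧
      (∀ k, gradient f (x k) = !₂[-1, -1]) ∧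
      (∀ k u v, iteratedFDeriv ℝ 2 f (x k) ![u, v] = H * u 1 * v 1) ∧
      (∀ k, ‖gradient f (x k)‖ = √2) :=
  mainTheorem7_general H (by linarith)
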